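/- Let $n\ge 2$ and $\alpha=(\alpha_1,\dots,\alpha_n)\in\mathbb R^n\setminus\{0\}$ (arbitrary real exponents, so both the rational case $\alpha\in\mathbb R\cdot\mathbb Z^n$ and the irrational case $\alpha\notin\mathbb R\cdot\mathbb Z^n$ are included). Put $\mathbb C^n(\alpha)=\{z\in\mathbb C^n : z_j\ne 0 \text{ whenever } \alpha_j<0\}$, $|z^\alpha|=|z_1|^{\alpha_1}\cdots|z_n|^{\alpha_n}$ for $z\in\mathbb C^n(\alpha)$ (with $0^0=1$), and let $D_\alpha=\{z\in\mathbb C^n(\alpha): |z^\alpha|<1\}$ be the elementary Reinhardt domain. For a domain $G\subset\mathbb C^n$ and $a,z\in G$ let the Sibony function be $$s_G(a,z)=\sup\{\sqrt{u(z)} : u\in\mathcal S_G(a)\},$$ where $\mathcal S_G(a)$ is the set of all functions $u:G\to[0,1)$ such that $\log u$ is plurisubharmonic on $G$ (with $\log 0=-\infty$, and the function identically $-\infty$ counted as plurisubharmonic), $u(a)=0$, and $u$ is of class $C^2$ (in the real sense) in a neighbourhood of $a$. Let $a\in D_\alpha$ be such that $\sigma(a):=\#\{j : \alpha_j>0,\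 a_j=0\}\ge 2$, and let $\mu(a):=\min\{\alpha_j : \alpha_j>0,\ a_j=0\}$. Then $$s_{D_\alpha}(a,z)=|z^\alpha|^{1/\mu(a)}\qquad\text{for all } z\in D_\alpha .$$ -/

import Mathlib

noncomputable section

namespace Sibony

/-- The mean over the unit circle of an extended-real-valued function `f`, i.e.
`(1 / 2π) ∫₀^{2π} f (e^{iθ}) dθ`, computed as the mean of the positive part minus the mean of the
negative part. For an upper semicontinuous `f` with values in `[-∞, ∞)` the first mean is finite,
so the difference is meaningful, with value in `[-∞, ∞)`. -/
def circleMean (f : ℂ → EReal) : EReal :=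
  ((MeasureTheory.laverage (MeasureTheory.volume.restrict (Set.Ioc (0 : ℝ) (2 * Real.pi)))
      fun θ : ℝ => (f (Complex.exp (θ * Complex.I))).toENNReal : ENNReal) : EReal) -
  ((MeasureTheory.laverage (MeasureTheory.volume.restrict (Set.Ioc (0 : ℝ) (2 * Real.pi)))
      fun θ : ℝ => (-f (Complex.exp (θ * Complex.I))).toENNReal : ENNReal) : EReal)

/-- Plurisubharmonic functions `v : G → [-∞, ∞)` on an open set `G ⊆ ℂⁿ` (the function `≡ -∞` is
allowed): upper semicontinuous, and satisfying the sub-mean value inequality on every closed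
affine complex disc `{c + ζ b : |ζ| ≤ 1}` contained in `G`. Values outside `G` are irrelevant. -/
structure IsPSH {n : ℕ} (G : Set (Fin n → ℂ)) (v : (Fin n → ℂ) → EReal) : Prop where
  ne_top : ∀ z ∈ G, v z ≠ ⊤
  usc : UpperSemicontinuousOn v G
  le_mean : ∀ c b : Fin n → ℂ, (∀ ζ : ℂ, ‖ζ‖ ≤ 1 → c + ζ • b ∈ G) →
    v c ≤ circleMean fun ζ => v (c + ζ • b)

/-- The class `𝒮_G(a)` of functions `u : G → [0, 1)` with `log u` plurisubharmonic on `G`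
(where `log 0 = -∞`), `u a = 0`, and `u` of class `C²` (in the real sense) in a neighbourhood
of `a`. -/
structure IsAdmissible {n : ℕ} (G : Set (Fin n → ℂ)) (a : Fin n → ℂ)
    (u : (Fin n → ℂ) → ℝ) : Prop where
  nonneg : ∀ z ∈ G, 0 ≤ u z
  lt_one : ∀ z ∈ G, u z < 1
  log_psh : IsPSH G fun z => ENNReal.log (ENNReal.ofReal (u z))
  map_base : u a = 0
  contDiffAt : ContDiffAt ℝ 2 u a

/-- The Sibony function `s_G(a, z) = sup {√(u z) : u ∈ 𝒮_G(a)}` of an open set `G ⊆ ℂⁿ`.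
For `z ∈ G` the set is nonempty (it contains the value of `u = 0`) and bounded above by `1`. -/
def sibony {n : ℕ} (G : Set (Fin n → ℂ)) (a z : Fin n → ℂ) : ℝ :=
  sSup {t : ℝ | ∃ u : (Fin n → ℂ) → ℝ, IsAdmissible G a u ∧ t = Real.sqrt (u z)}

/-- `|z^α| = |z₁|^{α₁} ⋯ |zₙ|^{αₙ}`, with `0⁰ = 1`. It is only used for `z ∈ ℂⁿ(α)`, where no
zero coordinate is raised to a negative power. -/
def absMonomial {n : ℕ} (α : Fin n → ℝ) (z : Fin n → ℂ) : ℝ :=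
  ∏ j, ‖z j‖ ^ α j

/-- The elementary Reinhardt domain `D_α = {z ∈ ℂⁿ(α) : |z^α| < 1}`, where `ℂⁿ(α)` is the set of
`z` with `z_j ≠ 0` whenever `α_j < 0`. -/
def reinhardt {n : ℕ} (α : Fin n → ℝ) : Set (Fin n → ℂ) :=
  {z | (∀ j, α j < 0 → z j ≠ 0) ∧ absMonomial α z < 1}

/-- The set of indices `j` with `α_j > 0` and `a_j = 0`. -/
def zeroIndices {n : ℕ} (α : Fin n → ℝ) (a : Fin n → ℂ) : Set (Fin n) :=
  {j | 0 < α j ∧ a j = 0}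

/-- `σ(a)`, the number of indices `j` with `α_j > 0` and `a_j = 0`. -/
def sigma {n : ℕ} (α : Fin n → ℝ) (a : Fin n → ℂ) : ℕ :=
  (zeroIndices α a).ncard

/-- `μ(a) = min {α_j : α_j > 0, a_j = 0}`; the set is finite, so that its infimum is its
minimum as soon as it is nonempty. -/
def mu {n : ℕ} (α : Fin n → ℝ) (a : Fin n → ℂ) : ℝ :=
  sInf (α '' zeroIndices α a)

end Sibony

end

/-!
Write `f z = |z^α|`, let `j` be an index with `α j = μ(a)`, `a j = 0`, and let `v = log u` for an
admissible `u`. The supremum is attained at `u = f ^ (2 / α j)`: its logarithm is a sum of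
multiples of `log |z k|`, with negative weights only where `z k` has no zero, and at the vanishing
coordinates of `a` the exponents `2 α k / α j` are `0` or at least `2`, so that `u` is of class
`C²` there (`isAdmissible_absMonomial_rpow`).

Conversely `u ≤ f ^ (2 / α j)` for every admissible `u` (`IsAdmissible.le_absMonomial_rpow`).
The hypersurface `{z j = 0}` contains complex lines through `a` on which `v`, being bounded
above, is constant, equal to `v a = -∞`. So `u` vanishes at points `p` arbitrarily close to `a`
all of whose coordinates except the `j`-th are nonzero. Near such a `p` the function `u ≥ 0` is
`C²`, hence `O(|t|²)` on the slice `z j = t` through `p`, and the Schwarz lemma for logarithmically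
subharmonic functions on that slice, which is a disc, is the desired inequality there. A point
with nonzero coordinates is joined to the slice by an entire curve `t ↦ (q k * exp (t * w k))` with
`∑ α k * w k = 0`; it stays in one level set of `f`, so `v` is constant along it by Liouville's
theorem. The remaining points are handled by the sub-mean value inequality on small discs.

Everything rests on a maximum principle for `v ∘ γ`, with `γ` an entire curve
(`IsPSH.comp_le_of_le_frontier`), although plurisubharmonicity is defined by affine discs only.
No regularization is needed: one doubles the variables and maximizes
`v (γ t + w) - h t + ε ‖t‖² - N |w|²`. At a maximum `(w₀, t₀)` the tangent line of `γ`
gives an affine disc `s ↦ γ t₀ + w₀ + s • γ'(t₀)`, on which the deviation of `γ` from its tangent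
is absorbed by `w`; it contributes a harmonic term and a term `o(|s|²)`, which is dominated by
`ε |s|²`, and this contradicts the sub-mean value inequality (`not_touching`).
-/

namespace Sibony

open Complex MeasureTheory Metric Set Filter Topology Real InnerProductSpace

/-! ### Circle means -/

lemma circleMean_mono_ae {f g : ℂ → EReal}
    (h : ∀ᵐ θ : ℝ, f (circleMap 0 1 θ) ≤ g (circleMap 0 1 θ)) : circleMean f ≤ circleMean g := by
  simp only [circleMap_zero, ofReal_one, one_mul] at h
  have h' := ae_restrict_of_ae (s := Ioc (0 : ℝ) (2 * π)) h
  refine EReal.sub_le_sub ?_ ?_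
  · rw [EReal.coe_ennreal_le_coe_ennreal_iff]
    exact laverage_mono_ae (h'.mono fun θ hθ => EReal.toENNReal_le_toENNReal hθ)
  · rw [EReal.coe_ennreal_le_coe_ennreal_iff]
    exact laverage_mono_ae
      (h'.mono fun θ hθ => EReal.toENNReal_le_toENNReal (EReal.neg_le_neg_iff.2 hθ))

lemma circleMean_mono {f g : ℂ → EReal} (h : ∀ ζ, ‖ζ‖ = 1 → f ζ ≤ g ζ) :
    circleMean f ≤ circleMean g :=
  circleMean_mono_ae (Eventually.of_forall fun θ => h _ (by simp))

lemma circleMean_coe {g : ℂ → ℝ} (hg : CircleIntegrable g 0 1) :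
    circleMean (fun ζ => (g ζ : EReal)) = (circleAverage g 0 1 : ℝ) := by
  have h2 : (0 : ℝ) ≤ 2 * π := by positivity
  set μ : Measure ℝ := volume.restrict (Ioc (0 : ℝ) (2 * π)) with hμ
  set F : ℝ → ℝ := fun θ => g (Complex.exp (θ * I)) with hF
  have hFc : F = fun θ => g (circleMap 0 1 θ) := by
    ext θ; simp [hF, circleMap]
  have hμu : μ univ = ENNReal.ofReal (2 * π) := by simp [hμ]
  have hint : Integrable F μ := by
    rw [hFc]; exact (intervalIntegrable_iff_integrableOn_Ioc_of_le h2).1 hg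
  have hint' : Integrable F ((μ univ)⁻¹ • μ) := by
    refine hint.smul_measure ?_
    rw [hμu]; simp [Real.pi_pos]
  have key : circleAverage g 0 1 = ∫ θ, F θ ∂((μ univ)⁻¹ • μ) := by
    rw [circleAverage_def, intervalIntegral.integral_of_le h2, integral_smul_measure, hμu, hFc,
      ENNReal.toReal_inv, ENNReal.toReal_ofReal h2]
  have hfin : ∀ {f : ℝ → ℝ}, Integrable f ((μ univ)⁻¹ • μ) →
      ∫⁻ θ, ENNReal.ofReal (f θ) ∂((μ univ)⁻¹ • μ) ≠ ⊤ := fun hf =>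
    ((lintegral_mono fun θ => ofReal_le_enorm _).trans_lt hf.2).ne
  have hneg : ∫⁻ θ, ENNReal.ofReal (-F θ) ∂((μ univ)⁻¹ • μ) ≠ ⊤ := hfin hint'.neg
  rw [key, integral_eq_lintegral_pos_part_sub_lintegral_neg_part hint', EReal.coe_sub,
    EReal.coe_ennreal_toReal (hfin hint'), EReal.coe_ennreal_toReal hneg]
  simp only [circleMean, laverage_eq', ← EReal.coe_neg, EReal.toENNReal_of_ne_top,
    EReal.coe_ne_top, ne_eq, not_false_eq_true, EReal.toReal_coe]
  rfl

/-! ### Plurisubharmonic functions on holomorphic curves -/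

lemma norm_sub_sq_sub_norm_sq (x y : ℂ) :
    ‖x - y‖ ^ 2 - ‖x‖ ^ 2 = (-2 * (starRingEnd ℂ x * y)).re + ‖y‖ ^ 2 := by
  simp only [← Complex.normSq_eq_norm_sq, Complex.normSq_apply, Complex.sub_re, Complex.sub_im,
    Complex.mul_re, Complex.mul_im, Complex.conj_re, Complex.conj_im, Complex.neg_re,
    Complex.neg_im, Complex.re_ofNat, Complex.im_ofNat]
  ring

/-- A plurisubharmonic `v` cannot be touched from above at `γ t₀ + w₀` by the penalized test function
`h t - ε ‖t‖² + N |w|²`, in the doubled variables `(w, t) ↦ γ t + w`. Restricted to the affine disc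
with direction `γ'(t₀)`, the test function is harmonic up to `-ε |s|² + N |ρ s|²`, where
`ρ s = o(s)`. -/
lemma not_touching {n : ℕ} {G : Set (Fin n → ℂ)} (hG : IsOpen G) {v : (Fin n → ℂ) → EReal}
    (hv : IsPSH G v) {γ : ℂ → Fin n → ℂ} (hγ : Differentiable ℂ γ) {h : ℂ → ℝ} {t₀ : ℂ}
    (hh : HarmonicAt h t₀) {w₀ : Fin n → ℂ} (hmem : γ t₀ + w₀ ∈ G) {V ε N : ℝ} (hε : 0 < ε)
    (hN : 0 ≤ N) (hV : v (γ t₀ + w₀) = V)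
    (hle : ∀ᶠ p : (Fin n → ℂ) × ℂ in 𝓝 (w₀, t₀), v (γ p.2 + p.1) ≤
      ((V + (h p.2 - h t₀) - ε * (‖p.2‖ ^ 2 - ‖t₀‖ ^ 2) +
        N * ∑ j, (‖p.1 j‖ ^ 2 - ‖w₀ j‖ ^ 2) : ℝ) : EReal)) : False := by
  set T : Fin n → ℂ := deriv γ t₀ with hT
  -- the deviation of `γ` from its tangent line at `t₀`; it is entire, vanishes at `0`, and is `o(s)`
  set ρ : ℂ → Fin n → ℂ := fun s => γ (t₀ + s) - γ t₀ - s • T with hρ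
  have hρ0 : ρ 0 = 0 := by simp [hρ]
  have hρd : Differentiable ℂ ρ := by
    have := hγ.comp (f := fun s : ℂ => t₀ + s) (by fun_prop)
    exact (this.sub_const _).sub (differentiable_id.smul_const T)
  obtain ⟨η, hη, hηle⟩ : ∃ η : ℝ, 0 < η ∧ N * (n * η ^ 2) ≤ ε / 2 := by
    refine ⟨√(ε / (2 * (N * n + 1))), by positivity, ?_⟩
    rw [Real.sq_sqrt (by positivity)]
    have : 0 ≤ N * n := by positivity
    rw [← mul_assoc, mul_div_assoc', div_le_div_iff₀ (by positivity) (by positivity)]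
    nlinarith
  have hsmall : ∀ᶠ s in 𝓝 (0 : ℂ), ‖ρ s‖ ≤ η * ‖s‖ :=
    (hasDerivAt_iff_isLittleO_nhds_zero.1 (hγ t₀).hasDerivAt).def hη
  -- the holomorphic function whose real part collects the terms linear in `t - t₀` and in `ρ`
  set F : ℂ → ℂ := fun t => -2 * (ε * starRingEnd ℂ t₀ * (t - t₀)) +
    N * ∑ j, -2 * (starRingEnd ℂ (w₀ j) * ρ (t - t₀) j) with hF
  have hFd : Differentiable ℂ F := by
    have : ∀ j, Differentiable ℂ fun t => ρ (t - t₀) j := fun j =>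
      (differentiable_pi.1 hρd j).comp (by fun_prop : Differentiable ℂ fun t : ℂ => t - t₀)
    simp only [hF]
    fun_prop
  set P : ℂ → ℝ := fun t => h t + (F t).re with hP
  have hPh : ∀ᶠ s in 𝓝 (0 : ℂ), HarmonicAt P (t₀ + s) := by
    have : Tendsto (fun s : ℂ => t₀ + s) (𝓝 0) (𝓝 t₀) := by
      simpa using (continuous_const_add t₀).tendsto (0 : ℂ)
    filter_upwards [this.eventually hh.eventually] with s hs
    exact hs.add (hFd.analyticAt _).harmonicAt_re
  have hGs : ∀ᶠ s in 𝓝 (0 : ℂ), γ t₀ + w₀ + s • T ∈ G := by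
    have : Continuous fun s : ℂ => γ t₀ + w₀ + s • T := by fun_prop
    exact this.continuousAt.eventually (hG.mem_nhds (by simpa using hmem))
  have hles : ∀ᶠ s in 𝓝 (0 : ℂ), v (γ (t₀ + s) + (w₀ - ρ s)) ≤
      ((V + (h (t₀ + s) - h t₀) - ε * (‖t₀ + s‖ ^ 2 - ‖t₀‖ ^ 2) +
        N * ∑ j, (‖w₀ j - ρ s j‖ ^ 2 - ‖w₀ j‖ ^ 2) : ℝ) : EReal) := by
    have hc : Continuous fun s : ℂ => ((w₀ - ρ s, t₀ + s) : (Fin n → ℂ) × ℂ) :=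
      (continuous_const.sub hρd.continuous).prodMk (by fun_prop)
    have := hc.tendsto 0
    simp only [hρ0, sub_zero, add_zero] at this
    exact this.eventually hle
  obtain ⟨r, hr, hball⟩ := Metric.nhds_basis_closedBall.eventually_iff.1
    (hsmall.and (hPh.and (hGs.and hles)))
  simp only [mem_closedBall_zero_iff] at hball
  have hrζ : ∀ ζ : ℂ, ‖ζ‖ ≤ 1 → ‖(r : ℂ) * ζ‖ ≤ r := fun ζ hζ => by
    rw [norm_mul, Complex.norm_real, Real.norm_of_nonneg hr.le]
    nlinarith
  have hPharm : HarmonicOnNhd P (closedBall t₀ |r|) := by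
    intro t ht
    rw [abs_of_pos hr, mem_closedBall, dist_eq_norm] at ht
    simpa using (hball ht).2.1
  have hF0 : F t₀ = 0 := by simp [hF, hρ0]
  have hmean := hPharm.circleAverage_eq
  rw [circleAverage_eq_circleAverage_zero_one] at hmean
  have hPint : CircleIntegrable (fun ζ => P (r * ζ + t₀)) 0 1 := by
    have : ContinuousOn P (closedBall t₀ r) := by
      simpa [abs_of_pos hr] using hPharm.continuousOn
    have hlin : Continuous fun ζ : ℂ => r * ζ + t₀ := by fun_prop
    refine (this.comp hlin.continuousOn ?_).circleIntegrable zero_le_one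
    intro ζ hζ
    simp only [mem_sphere_zero_iff_norm] at hζ
    simpa using hrζ ζ hζ.le
  have hsub := hv.le_mean (γ t₀ + w₀) ((r : ℂ) • T) fun ζ hζ => by
    have := (hball (hrζ ζ hζ)).2.2.1
    rwa [smul_smul, mul_comm ζ]
  have hbound : ∀ ζ : ℂ, ‖ζ‖ = 1 → v (γ t₀ + w₀ + ζ • (r : ℂ) • T) ≤
      ((P (r * ζ + t₀) + (V - h t₀ - ε / 2 * r ^ 2) : ℝ) : EReal) := by
    intro ζ hζ
    obtain ⟨h1, -, -, h4⟩ := hball (hrζ ζ hζ.le)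
    have hnr : ‖(r : ℂ) * ζ‖ = r := by simp [hζ, abs_of_pos hr]
    generalize hs : (r : ℂ) * ζ = s at h1 h4 hnr
    have e1 : γ t₀ + w₀ + ζ • (r : ℂ) • T = γ (t₀ + s) + (w₀ - ρ s) := by
      rw [smul_smul, mul_comm ζ, hs]; simp only [hρ]; abel
    rw [e1]
    refine h4.trans (EReal.coe_le_coe_iff.2 ?_)
    have e2 : ‖t₀ + s‖ ^ 2 - ‖t₀‖ ^ 2 = (2 * (starRingEnd ℂ t₀ * s)).re + r ^ 2 := by
      have := norm_sub_sq_sub_norm_sq t₀ (-s)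
      simpa [hnr] using this
    have e3 : ∑ j, (‖w₀ j - ρ s j‖ ^ 2 - ‖w₀ j‖ ^ 2) =
        (∑ j, -2 * (starRingEnd ℂ (w₀ j) * ρ s j)).re + ∑ j, ‖ρ s j‖ ^ 2 := by
      simp only [norm_sub_sq_sub_norm_sq, Finset.sum_add_distrib, Complex.re_sum]
    have e4 : ∑ j, ‖ρ s j‖ ^ 2 ≤ n * η ^ 2 * r ^ 2 := by
      have : ∀ j ∈ Finset.univ, ‖ρ s j‖ ^ 2 ≤ η ^ 2 * r ^ 2 := fun j _ => by
        rw [← mul_pow]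
        exact pow_le_pow_left₀ (norm_nonneg _) ((norm_le_pi_norm _ j).trans (hnr ▸ h1)) 2
      simpa [mul_assoc] using Finset.sum_le_card_nsmul _ _ _ this
    have e5 : (F (s + t₀)).re = -ε * (2 * (starRingEnd ℂ t₀ * s)).re +
        N * (∑ j, -2 * (starRingEnd ℂ (w₀ j) * ρ s j)).re := by
      simp only [hF, add_sub_cancel_right, Complex.add_re, Complex.re_ofReal_mul]
      congr 1
      rw [← Complex.re_ofReal_mul]
      congr 1
      push_cast; ring
    have e6 : N * ∑ j, ‖ρ s j‖ ^ 2 ≤ ε / 2 * r ^ 2 := by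
      calc _ ≤ N * (n * η ^ 2 * r ^ 2) := by gcongr
        _ = N * (n * η ^ 2) * r ^ 2 := by ring
        _ ≤ _ := by gcongr
    rw [e2, e3, hP]
    simp only [add_comm s t₀] at e5 ⊢
    rw [e5]
    nlinarith
  have hfin := hsub.trans (circleMean_mono hbound)
  have hci : CircleIntegrable (fun ζ => P (r * ζ + t₀) + (V - h t₀ - ε / 2 * r ^ 2)) 0 1 :=
    hPint.add (circleIntegrable_const _ _ _)
  rw [circleMean_coe hci, circleAverage_fun_add hPint (circleIntegrable_const _ _ _),
    hmean, circleAverage_const, hV, EReal.coe_le_coe_iff] at hfin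
  simp only [hP, hF0, Complex.zero_re] at hfin
  have : 0 < ε / 2 * r ^ 2 := by positivity
  linarith

lemma norm_sq_le_sum_norm_sq {n : ℕ} (w : Fin n → ℂ) : ‖w‖ ^ 2 ≤ ∑ j, ‖w j‖ ^ 2 := by
  have h0 : 0 ≤ ∑ j, ‖w j‖ ^ 2 := by positivity
  rw [← Real.sq_sqrt h0]
  refine pow_le_pow_left₀ (norm_nonneg _) ((pi_norm_le_iff_of_nonneg (Real.sqrt_nonneg _)).2
    fun j => Real.le_sqrt_of_sq_le ?_) 2
  exact Finset.single_le_sum (f := fun j => ‖w j‖ ^ 2) (fun _ _ => by positivity)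
    (Finset.mem_univ j)

/-- Maximum principle along a holomorphic curve: if `v ∘ γ` is bounded by a function `h` harmonic in
the interior of a compact set `K` on the frontier of `K`, then it is so on `K`. -/
theorem IsPSH.comp_le_of_le_frontier {n : ℕ} {G : Set (Fin n → ℂ)} (hG : IsOpen G)
    {v : (Fin n → ℂ) → EReal} (hv : IsPSH G v) {γ : ℂ → Fin n → ℂ} (hγ : Differentiable ℂ γ)
    {K : Set ℂ} (hK : IsCompact K) (hγK : ∀ t ∈ K, γ t ∈ G) {h : ℂ → ℝ} (hc : ContinuousOn h K)
    (hh : ∀ t ∈ interior K, HarmonicAt h t) (hle : ∀ t ∈ frontier K, v (γ t) ≤ h t) {t : ℂ}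
    (ht : t ∈ K) : v (γ t) ≤ h t := by
  by_contra! hlt
  obtain ⟨V₁, hV₁⟩ : ∃ V₁ : ℝ, v (γ t) = V₁ :=
    ⟨_, (EReal.coe_toReal (hv.ne_top _ (hγK t ht)) (bot_lt_of_lt hlt).ne').symm⟩
  rw [hV₁, EReal.coe_lt_coe_iff] at hlt
  obtain ⟨R, hR, hKR⟩ := hK.isBounded.exists_pos_norm_le
  set m : ℝ := (V₁ - h t) / 2 with hm
  have hmpos : 0 < m := by rw [hm]; linarith
  set ε : ℝ := m / R ^ 2 with hε
  have hεpos : 0 < ε := by positivity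
  have hεR : ε * R ^ 2 = m := by rw [hε]; field_simp
  -- A strictly superharmonic majorant of `h` on `K`, still below `v ∘ γ` at `t`.
  set k : ℂ → ℝ := fun s => h s + ε * (R ^ 2 - ‖s‖ ^ 2) with hk
  have hkh : ∀ s ∈ K, h s ≤ k s := fun s hs => by
    have : ‖s‖ ^ 2 ≤ R ^ 2 := pow_le_pow_left₀ (norm_nonneg _) (hKR s hs) 2
    have := mul_nonneg hεpos.le (sub_nonneg.2 this)
    simp only [hk]; linarith
  have hkc : ContinuousOn k K := hc.add (by fun_prop)
  have hkt : m ≤ V₁ - k t := by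
    have : 0 ≤ ε * ‖t‖ ^ 2 := by positivity
    simp only [hk, mul_sub, hεR]; linarith
  have hγc : Continuous fun p : (Fin n → ℂ) × ℂ => γ p.2 + p.1 :=
    (hγ.continuous.comp continuous_snd).add continuous_fst
  have hin : ∀ᶠ w in 𝓝 (0 : Fin n → ℂ), ∀ s ∈ K, γ s + w ∈ G :=
    hK.eventually_forall_of_forall_eventually (P := fun w s => γ s + w ∈ G) fun s hs =>
      hγc.continuousAt.eventually (hG.mem_nhds (by simpa using hγK s hs))
  have hfr : ∀ᶠ w in 𝓝 (0 : Fin n → ℂ), ∀ s ∈ frontier K, s ∈ K →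
      v (γ s + w) < ((k s + m : ℝ) : EReal) := by
    refine (hK.diff isOpen_interior |>.of_isClosed_subset isClosed_frontier
      (by rw [hK.isClosed.frontier_eq])).eventually_forall_of_forall_eventually
      (P := fun w s => s ∈ K → v (γ s + w) < ((k s + m : ℝ) : EReal)) fun s hs => ?_
    have hsK : s ∈ K := hK.isClosed.frontier_subset hs
    have h1 : ∀ᶠ p : (Fin n → ℂ) × ℂ in 𝓝 (0, s),
        v (γ p.2 + p.1) < ((k s + m / 2 : ℝ) : EReal) := by
      have hu := hv.usc (γ s) (hγK s hsK) ((k s + m / 2 : ℝ) : EReal)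
        ((hle s hs).trans_lt (EReal.coe_lt_coe_iff.2 (by linarith [hkh s hsK])))
      rw [hG.nhdsWithin_eq (hγK s hsK)] at hu
      have := hγc.tendsto (0, s)
      simp only [add_zero] at this
      exact this.eventually hu
    have h2 : ∀ᶠ p : (Fin n → ℂ) × ℂ in 𝓝 (0, s), p.2 ∈ K → k s - m / 2 < k p.2 := by
      have := (hkc s hsK).eventually (lt_mem_nhds (show k s - m / 2 < k s by linarith))
      exact (continuous_snd.tendsto ((0 : Fin n → ℂ), s)).eventually
        (eventually_nhdsWithin_iff.1 this)
    filter_upwards [h1, h2] with p hp1 hp2 hpK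
    exact hp1.trans (EReal.coe_lt_coe_iff.2 (by linarith [hp2 hpK]))
  obtain ⟨δ, hδ, hball⟩ := Metric.nhds_basis_closedBall.eventually_iff.1 (hin.and hfr)
  set C : Set ((Fin n → ℂ) × ℂ) := closedBall 0 δ ×ˢ K with hC
  have hCc : IsCompact C := (isCompact_closedBall _ _).prod hK
  have hne : C.Nonempty := ⟨(0, t), by simp [hδ.le], ht⟩
  have husc : UpperSemicontinuousOn (fun p : (Fin n → ℂ) × ℂ => v (γ p.2 + p.1)) C :=
    UpperSemicontinuousOn.comp (f := v) hv.usc hγc.continuousOn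
      fun p hp => (hball hp.1).1 p.2 hp.2
  obtain ⟨B, hB⟩ : ∃ B : ℝ, ∀ p ∈ C, v (γ p.2 + p.1) ≤ B := by
    obtain ⟨p, hp, hmax⟩ := husc.exists_isMaxOn hne hCc
    exact ⟨_, fun q hq => (hmax hq).trans
      (EReal.le_coe_toReal (hv.ne_top _ ((hball hp.1).1 p.2 hp.2)))⟩
  obtain ⟨κ, hκ⟩ : ∃ κ : ℝ, ∀ s ∈ K, κ ≤ k s := by
    obtain ⟨κ, hκ⟩ := hK.bddBelow_image hkc
    exact ⟨κ, fun s hs => hκ (mem_image_of_mem k hs)⟩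
  -- With this penalty the maximum below is not attained at `‖w‖ = δ`.
  obtain ⟨N, hN, hNδ⟩ : ∃ N : ℝ, 0 ≤ N ∧ B - κ - m < N * δ ^ 2 := by
    refine ⟨(|B - κ - m| + 1) / δ ^ 2, by positivity, ?_⟩
    rw [div_mul_cancel₀ _ (by positivity)]
    linarith [le_abs_self (B - κ - m)]
  set q : (Fin n → ℂ) → ℝ := fun w => ∑ j, ‖w j‖ ^ 2 with hq
  have hqc : Continuous q := by fun_prop
  have hq0 : ∀ w, 0 ≤ q w := fun w => by positivity
  have hΨ : UpperSemicontinuousOn (fun p : (Fin n → ℂ) × ℂ =>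
      v (γ p.2 + p.1) + ((-k p.2 - N * q p.1 : ℝ) : EReal)) C := by
    refine husc.add' (ContinuousOn.upperSemicontinuousOn ?_) fun p hp =>
      EReal.continuousAt_add (Or.inr (EReal.coe_ne_bot _)) (Or.inr (EReal.coe_ne_top _))
    refine continuous_coe_real_ereal.comp_continuousOn (ContinuousOn.sub ?_ (by fun_prop))
    exact (hkc.comp continuousOn_snd fun p hp => hp.2).neg
  obtain ⟨⟨w₀, t₀⟩, hp₀, hmax⟩ := hΨ.exists_isMaxOn hne hCc
  obtain ⟨hw₀ : w₀ ∈ closedBall 0 δ, ht₀ : t₀ ∈ K⟩ := hp₀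
  have hmem : γ t₀ + w₀ ∈ G := (hball hw₀).1 t₀ ht₀
  have hΨt : ((V₁ - k t : ℝ) : EReal) ≤ v (γ t₀ + w₀) + ((-k t₀ - N * q w₀ : ℝ) : EReal) := by
    have := hmax (show ((0, t) : (Fin n → ℂ) × ℂ) ∈ C from ⟨by simp [hδ.le], ht⟩)
    simpa [hV₁, hq, sub_eq_add_neg] using this
  obtain ⟨V, hV⟩ : ∃ V : ℝ, v (γ t₀ + w₀) = V := by
    refine ⟨_, (EReal.coe_toReal (hv.ne_top _ hmem) fun hbot => ?_).symm⟩
    rw [hbot, EReal.bot_add] at hΨt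
    exact (EReal.bot_lt_coe _).not_ge hΨt
  rw [hV, ← EReal.coe_add, EReal.coe_le_coe_iff] at hΨt
  -- On the frontier `v (γ t + w) - k t < m` for small `w`, whereas the maximum is at least `m`.
  have ht₀i : t₀ ∈ interior K := by
    by_contra hni
    have := (hball hw₀).2 t₀ (hK.isClosed.frontier_eq ▸ ⟨ht₀, hni⟩) ht₀
    rw [hV, EReal.coe_lt_coe_iff] at this
    linarith [mul_nonneg hN (hq0 w₀)]
  have hw₀i : w₀ ∈ ball 0 δ := by
    rw [mem_ball_zero_iff]
    refine lt_of_le_of_ne (mem_closedBall_zero_iff.1 hw₀) fun heq => ?_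
    have h1 := hB (w₀, t₀) ⟨hw₀, ht₀⟩
    rw [hV, EReal.coe_le_coe_iff] at h1
    have h2 : N * δ ^ 2 ≤ N * q w₀ := by
      rw [← heq]; exact mul_le_mul_of_nonneg_left (norm_sq_le_sum_norm_sq w₀) hN
    linarith [hκ t₀ ht₀]
  refine not_touching hG hv hγ (hh t₀ ht₀i) hmem hεpos hN hV ?_
  have hnhds : C ∈ 𝓝 (w₀, t₀) := by
    refine mem_of_superset ((isOpen_ball.prod isOpen_interior).mem_nhds ⟨hw₀i, ht₀i⟩) ?_
    exact prod_mono ball_subset_closedBall interior_subset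
  filter_upwards [hnhds] with p hp
  have h1 : v (γ p.2 + p.1) + ((-k p.2 - N * q p.1 : ℝ) : EReal) ≤
      v (γ t₀ + w₀) + ((-k t₀ - N * q w₀ : ℝ) : EReal) := hmax hp
  have h2 : ∑ j, (‖p.1 j‖ ^ 2 - ‖w₀ j‖ ^ 2) = q p.1 - q w₀ := by
    simp only [hq, Finset.sum_sub_distrib]
  rw [h2]
  rw [hV] at h1
  induction hx : v (γ p.2 + p.1) with
  | bot => exact bot_le
  | top => exact absurd hx (hv.ne_top _ ((hball hp.1).1 p.2 hp.2))
  | coe x =>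
    rw [hx, ← EReal.coe_add, ← EReal.coe_add, EReal.coe_le_coe_iff] at h1
    rw [EReal.coe_le_coe_iff]
    simp only [hk] at h1
    linarith

/-! ### Annuli, Liouville's theorem and a Schwarz lemma -/

/-- Comparison of `v ∘ γ` with the radial harmonic functions `A + B * log ‖t‖` on an annulus. -/
lemma IsPSH.comp_le_log_of_annulus {n : ℕ} {G : Set (Fin n → ℂ)} (hG : IsOpen G)
    {v : (Fin n → ℂ) → EReal} (hv : IsPSH G v) {γ : ℂ → Fin n → ℂ} (hγ : Differentiable ℂ γ)
    {r₁ r₂ A B : ℝ} (hr₁ : 0 < r₁) (hγG : ∀ t, r₁ ≤ ‖t‖ → ‖t‖ ≤ r₂ → γ t ∈ G)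
    (h₁ : ∀ t, ‖t‖ = r₁ → v (γ t) ≤ ((A + B * Real.log r₁ : ℝ) : EReal))
    (h₂ : ∀ t, ‖t‖ = r₂ → v (γ t) ≤ ((A + B * Real.log r₂ : ℝ) : EReal))
    {t : ℂ} (ht₁ : r₁ ≤ ‖t‖) (ht₂ : ‖t‖ ≤ r₂) :
    v (γ t) ≤ ((A + B * Real.log ‖t‖ : ℝ) : EReal) := by
  set K : Set ℂ := {s | r₁ ≤ ‖s‖ ∧ ‖s‖ ≤ r₂} with hK
  have hKcl : IsClosed K := (isClosed_le continuous_const continuous_norm).inter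
    (isClosed_le continuous_norm continuous_const)
  have hKc : IsCompact K := (isCompact_closedBall (0 : ℂ) r₂).of_isClosed_subset hKcl
    fun s hs => by simpa using hs.2
  have hne : ∀ s ∈ K, s ≠ 0 := fun s hs => norm_pos_iff.1 (hr₁.trans_le hs.1)
  have hint : {s : ℂ | r₁ < ‖s‖ ∧ ‖s‖ < r₂} ⊆ interior K :=
    interior_maximal (fun s hs => ⟨hs.1.le, hs.2.le⟩)
      ((isOpen_lt continuous_const continuous_norm).inter
        (isOpen_lt continuous_norm continuous_const))
  refine hv.comp_le_of_le_frontier hG hγ hKc (h := fun s => A + B * Real.log ‖s‖)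
    (fun s hs => hγG s hs.1 hs.2) ?_ (fun s hs => ?_) (fun s hs => ?_) (t := t) ⟨ht₁, ht₂⟩
  · exact continuousOn_const.add (continuousOn_const.mul
      (continuous_norm.continuousOn.log fun s hs => norm_ne_zero_iff.2 (hne s hs)))
  · exact (harmonicAt_const A).add (HarmonicAt.const_smul (c := B)
      (analyticAt_id.harmonicAt_log_norm (hne s (interior_subset hs))))
  · rw [hKcl.frontier_eq] at hs
    obtain ⟨⟨hs₁, hs₂⟩, hs⟩ := hs
    rcases hs₁.eq_or_lt with h | h
    · simpa only [← h] using h₁ s h.symm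
    rcases hs₂.eq_or_lt with h' | h'
    · simpa only [h'] using h₂ s h'
    · exact absurd (hint ⟨h, h'⟩) hs

/-- Liouville's theorem: a nonpositive plurisubharmonic function does not exceed its value at `γ 0`
along an entire curve `γ`. Since `0` could be any point of the curve, it is constant there. -/
lemma IsPSH.comp_le_comp_zero {n : ℕ} {G : Set (Fin n → ℂ)} (hG : IsOpen G)
    {v : (Fin n → ℂ) → EReal} (hv : IsPSH G v) (hv0 : ∀ z ∈ G, v z ≤ 0)
    {γ : ℂ → Fin n → ℂ} (hγ : Differentiable ℂ γ) (hγG : ∀ t, γ t ∈ G) (t : ℂ) :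
    v (γ t) ≤ v (γ 0) := by
  by_contra! hlt
  obtain ⟨A, hA, hAt⟩ := EReal.lt_iff_exists_real_btwn.1 hlt
  obtain ⟨x, hx⟩ : ∃ x : ℝ, v (γ t) = x :=
    ⟨_, (EReal.coe_toReal (hv.ne_top _ (hγG t)) (bot_lt_of_lt hAt).ne').symm⟩
  rw [hx, EReal.coe_lt_coe_iff] at hAt
  have hnear : ∀ᶠ s in 𝓝 (0 : ℂ), v (γ s) < A := by
    have := hv.usc (γ 0) (hγG 0) A hA
    rw [hG.nhdsWithin_eq (hγG 0)] at this
    exact hγ.continuous.continuousAt.eventually this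
  obtain ⟨ρ₀, hρ₀, hball⟩ := Metric.nhds_basis_closedBall.eventually_iff.1 hnear
  have ht : 0 < ‖t‖ := norm_pos_iff.2 fun h => by simp [h] at hlt
  obtain ⟨ρ, hρ, hρle⟩ : ∃ ρ, 0 < ρ ∧ ρ ≤ ρ₀ ∧ ρ ≤ ‖t‖ :=
    ⟨min ρ₀ ‖t‖, lt_min hρ₀ ht, min_le_left _ _, min_le_right _ _⟩
  have hL : 0 ≤ Real.log ‖t‖ - Real.log ρ := sub_nonneg.2 (Real.log_le_log hρ hρle.2)
  -- a slope so small that `A + B * (log ‖t‖ - log ρ) < x`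
  set B : ℝ := (x - A) / (2 * (Real.log ‖t‖ - Real.log ρ + 1)) with hB
  have hBpos : 0 < B := div_pos (by linarith) (by linarith)
  -- an outer radius at which `A + B * (log R - log ρ)` is nonnegative, hence bounds `v`
  set R : ℝ := max ‖t‖ (ρ * Real.exp (|A| / B)) with hR
  have hR0 : 0 ≤ A - B * Real.log ρ + B * Real.log R := by
    have h1 : Real.log ρ + |A| / B ≤ Real.log R := by
      rw [← Real.log_exp (|A| / B), ← Real.log_mul hρ.ne' (Real.exp_pos _).ne']
      exact Real.log_le_log (by positivity) (le_max_right _ _)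
    have h2 : B * (Real.log ρ + |A| / B) ≤ B * Real.log R := by gcongr
    rw [mul_add, mul_div_cancel₀ _ hBpos.ne'] at h2
    linarith [neg_abs_le A]
  have := hv.comp_le_log_of_annulus hG hγ (r₁ := ρ) (r₂ := R) (A := A - B * Real.log ρ) (B := B)
    hρ (fun s _ _ => hγG s) (fun s hs => ?_) (fun s hs => ?_) hρle.2 (le_max_left _ _)
  · rw [hx, EReal.coe_le_coe_iff] at this
    have h3 : B * (2 * (Real.log ‖t‖ - Real.log ρ + 1)) = x - A :=
      div_mul_cancel₀ _ (by linarith : (0 : ℝ) < 2 * (Real.log ‖t‖ - Real.log ρ + 1)).ne'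
    linarith
  · rw [sub_add_cancel]
    exact (hball (by simpa [hs] using hρle.1)).le
  · exact (hv0 _ (hγG s)).trans (EReal.coe_nonneg.2 hR0)

/-- Schwarz lemma: if a nonpositive plurisubharmonic `v` satisfies `v (γ t) ≤ 2 log ‖t‖ + O(1)` at
`0`, then `v (γ t) ≤ 2 log (‖t‖ / r)` on the disc of radius `r`. -/
lemma IsPSH.comp_le_two_mul_log {n : ℕ} {G : Set (Fin n → ℂ)} (hG : IsOpen G)
    {v : (Fin n → ℂ) → EReal} (hv : IsPSH G v) (hv0 : ∀ z ∈ G, v z ≤ 0)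
    {γ : ℂ → Fin n → ℂ} (hγ : Differentiable ℂ γ) {r : ℝ} (hγG : ∀ t, ‖t‖ < r → γ t ∈ G) {c : ℝ}
    (hc : ∀ᶠ t in 𝓝[≠] (0 : ℂ), v (γ t) ≤ ((c + 2 * Real.log ‖t‖ : ℝ) : EReal))
    {t : ℂ} (ht0 : t ≠ 0) (ht : ‖t‖ < r) :
    v (γ t) ≤ ((2 * (Real.log ‖t‖ - Real.log r) : ℝ) : EReal) := by
  have hr : 0 < r := (norm_nonneg t).trans_lt ht
  have hti : 0 < ‖t‖ := norm_pos_iff.2 ht0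
  -- The slope `2 - ε` makes the comparison function dominate `2 log ‖t‖ + c` near `0`; the radius
  -- `r * exp (-ε)` keeps the boundary circle inside the domain.
  have key : ∀ ε : ℝ, 0 < ε → ‖t‖ < r * Real.exp (-ε) →
      v (γ t) ≤ (((2 - ε) * (Real.log ‖t‖ - Real.log r + ε) : ℝ) : EReal) := by
    intro ε hε htε
    have hlogr : Real.log (r * Real.exp (-ε)) = Real.log r - ε := by
      rw [Real.log_mul hr.ne' (Real.exp_pos _).ne', Real.log_exp]; ring
    obtain ⟨ρ₀, hρ₀, hball⟩ := Metric.nhds_basis_closedBall.eventually_iff.1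
      (eventually_nhdsWithin_iff.1 hc)
    have hlog : ∀ᶠ ρ in 𝓝[>] (0 : ℝ), Real.log ρ ≤ (-(2 - ε) * (Real.log r - ε) - c) / ε :=
      Real.tendsto_log_nhdsGT_zero.eventually (eventually_le_atBot _)
    obtain ⟨ρ, ⟨hρlog, hρ₀', hρt⟩, hρ⟩ := ((hlog.and ((eventually_nhdsWithin_of_eventually_nhds
      (eventually_le_nhds hρ₀)).and (eventually_nhdsWithin_of_eventually_nhds
      (eventually_le_nhds hti)))).and self_mem_nhdsWithin).exists
    have hρ : 0 < ρ := hρ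
    rw [le_div_iff₀ hε] at hρlog
    have := hv.comp_le_log_of_annulus hG hγ (r₁ := ρ) (r₂ := r * Real.exp (-ε))
      (A := -(2 - ε) * (Real.log r - ε)) (B := 2 - ε) hρ
      (fun s _ hs => hγG s (hs.trans_lt ?_)) (fun s hs => ?_) (fun s hs => ?_) hρt htε.le
    · refine this.trans (EReal.coe_le_coe_iff.2 (le_of_eq (by ring)))
    · exact mul_lt_of_lt_one_right hr (by simpa using hε)
    · refine (hball (by simpa [hs] using hρ₀')
        (norm_pos_iff.1 (hs ▸ hρ))).trans (EReal.coe_le_coe_iff.2 ?_)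
      rw [hs]; linarith
    · have hs' : ‖s‖ < r := hs ▸ mul_lt_of_lt_one_right hr (by simpa using hε)
      refine (hv0 _ (hγG s hs')).trans (EReal.coe_nonneg.2 (le_of_eq ?_))
      rw [hlogr]; ring
  have hev : ∀ᶠ ε in 𝓝[>] (0 : ℝ), ‖t‖ < r * Real.exp (-ε) := by
    have : Tendsto (fun ε : ℝ => r * Real.exp (-ε)) (𝓝 0) (𝓝 r) := by
      have h : Continuous fun ε : ℝ => r * Real.exp (-ε) := by fun_prop
      simpa using h.tendsto 0
    exact eventually_nhdsWithin_of_eventually_nhds (this.eventually (lt_mem_nhds ht))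
  have hlim : Tendsto (fun ε : ℝ => (((2 - ε) * (Real.log ‖t‖ - Real.log r + ε) : ℝ) : EReal))
      (𝓝[>] 0) (𝓝 ((2 * (Real.log ‖t‖ - Real.log r) : ℝ) : EReal)) := by
    have h : Continuous fun ε : ℝ => (((2 - ε) * (Real.log ‖t‖ - Real.log r + ε) : ℝ) : EReal) :=
      continuous_coe_real_ereal.comp (by fun_prop)
    simpa using (h.tendsto 0).mono_left nhdsWithin_le_nhds
  exact ge_of_tendsto hlim (by filter_upwards [hev, self_mem_nhdsWithin] with ε h1 h2
                               using key ε h2 h1)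

/-! ### Upper bound for admissible functions -/

lemma log_ofReal_le_coe_iff {x y : ℝ} :
    ENNReal.log (ENNReal.ofReal y) ≤ (x : EReal) ↔ y ≤ Real.exp x := by
  rw [← Real.log_exp x, ← ENNReal.log_ofReal_of_pos (Real.exp_pos x), ENNReal.log_le_log_iff,
    ENNReal.ofReal_le_ofReal_iff (Real.exp_pos x).le, Real.log_exp]

lemma absMonomial_nonneg {n : ℕ} (α : Fin n → ℝ) (z : Fin n → ℂ) : 0 ≤ absMonomial α z :=
  Finset.prod_nonneg fun _ _ => Real.rpow_nonneg (norm_nonneg _) _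

lemma absMonomial_eq_zero {n : ℕ} {α : Fin n → ℝ} {z : Fin n → ℂ} {j : Fin n}
    (hα : α j ≠ 0) (hz : z j = 0) : absMonomial α z = 0 :=
  Finset.prod_eq_zero (Finset.mem_univ j) (by rw [hz, norm_zero, Real.zero_rpow hα])

lemma continuousOn_absMonomial {n : ℕ} (α : Fin n → ℝ) :
    ContinuousOn (absMonomial α) {z | ∀ j, α j < 0 → z j ≠ 0} := by
  refine continuousOn_finsetProd _ fun j _ => ?_
  refine ContinuousOn.rpow_const (by fun_prop) fun z hz => ?_
  by_cases h : α j < 0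
  · exact Or.inl (norm_ne_zero_iff.2 (hz j h))
  · exact Or.inr (not_lt.1 h)

lemma isOpen_reinhardt {n : ℕ} (α : Fin n → ℝ) : IsOpen (reinhardt α) := by
  refine (continuousOn_absMonomial α).isOpen_inter_preimage ?_ isOpen_Iio
  simp only [ofPred_forall]
  refine isOpen_iInter_of_finite fun j => isOpen_iInter_of_finite fun _ => ?_
  exact isOpen_ne_fun (continuous_apply j) continuous_const

lemma continuousOn_absMonomial_reinhardt {n : ℕ} (α : Fin n → ℝ) :
    ContinuousOn (absMonomial α) (reinhardt α) :=
  (continuousOn_absMonomial α).mono fun _ hz => hz.1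

/-- `|z^α|` is constant along the curves `t ↦ (z j * exp (t * w j))` with `∑ α j * w j = 0`. -/
lemma absMonomial_mul_exp {n : ℕ} {α : Fin n → ℝ} {w : Fin n → ℂ}
    (hw : ∑ j, (α j : ℂ) * w j = 0) (z : Fin n → ℂ) (t : ℂ) :
    absMonomial α (fun j => z j * Complex.exp (t * w j)) = absMonomial α z := by
  have h1 : ∀ j, ‖z j * Complex.exp (t * w j)‖ ^ α j =
      ‖z j‖ ^ α j * Real.exp (t * (α j * w j)).re := fun j => by
    rw [norm_mul, Real.mul_rpow (norm_nonneg _) (norm_nonneg _), Complex.norm_exp,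
      ← Real.exp_mul, mul_left_comm t, Complex.re_ofReal_mul, mul_comm (α j)]
  simp only [absMonomial, h1, Finset.prod_mul_distrib, ← Real.exp_sum, ← Complex.re_sum,
    ← Finset.mul_sum, hw, mul_zero, Complex.zero_re, Real.exp_zero, mul_one]

lemma absMonomial_update {n : ℕ} (α : Fin n → ℝ) (p : Fin n → ℂ) (j : Fin n) (t : ℂ) :
    absMonomial α (Function.update p j t) =
      ‖t‖ ^ α j * ∏ k ∈ Finset.univ.erase j, ‖p k‖ ^ α k := by
  rw [absMonomial, ← Finset.mul_prod_erase _ _ (Finset.mem_univ j), Function.update_self]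
  congr 1
  refine Finset.prod_congr rfl fun k hk => ?_
  rw [Function.update_of_ne (Finset.ne_of_mem_erase hk)]

lemma differentiable_update {n : ℕ} (p : Fin n → ℂ) (j : Fin n) :
    Differentiable ℂ fun t : ℂ => Function.update p j t := by
  refine differentiable_pi.2 fun k => ?_
  rcases eq_or_ne k j with rfl | h
  · simp
  · simp [Function.update_of_ne h]

/-- A `C²` function grows at most quadratically near a local minimum: its derivative vanishes there
and is locally Lipschitz. -/
lemma exists_le_mul_norm_sq {E : Type*} [NormedAddCommGroup E] [NormedSpace ℝ E] {g : E → ℝ}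
    {x : E} (hg : ContDiffAt ℝ 2 g x) (hmin : IsLocalMin g x) :
    ∃ C : ℝ, 0 < C ∧ ∀ᶠ y in 𝓝 x, g y - g x ≤ C * ‖y - x‖ ^ 2 := by
  obtain ⟨K, s, hs, hK⟩ := (hg.fderiv_right (m := 1) (by norm_num)).exists_lipschitzOnWith
  have hd : ∀ᶠ y in 𝓝 x, DifferentiableAt ℝ g y :=
    (hg.eventually (by simp)).mono fun y hy => hy.differentiableAt (by simp)
  obtain ⟨r, hr, hball⟩ := Metric.eventually_nhds_iff_ball.1 (hd.and (eventually_mem_set.2 hs))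
  refine ⟨K + 1, by positivity, Metric.eventually_nhds_iff_ball.2 ⟨r, hr, fun y hy => ?_⟩⟩
  have hsub : closedBall x ‖y - x‖ ⊆ ball x r :=
    closedBall_subset_ball (by rwa [← dist_eq_norm])
  have hmv := (convex_closedBall x ‖y - x‖).norm_image_sub_le_of_norm_fderiv_le
    (f := g) (C := K * ‖y - x‖) (𝕜 := ℝ) (fun z hz => (hball z (hsub hz)).1) (fun z hz => ?_)
    (mem_closedBall_self (norm_nonneg _)) (y := y) (by rw [mem_closedBall, dist_eq_norm])
  · calc g y - g x ≤ ‖g y - g x‖ := Real.le_norm_self _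
      _ ≤ K * ‖y - x‖ * ‖y - x‖ := hmv
      _ ≤ _ := by nlinarith [sq_nonneg ‖y - x‖]
  · have := hK.norm_sub_le (hball z (hsub hz)).2 (hball x (mem_ball_self hr)).2
    rw [hmin.fderiv_eq_zero, sub_zero] at this
    refine this.trans (mul_le_mul_of_nonneg_left ?_ K.coe_nonneg)
    rwa [← dist_eq_norm, ← mem_closedBall]

section UpperBound

variable {n : ℕ} {α : Fin n → ℝ} {a : Fin n → ℂ} {u : (Fin n → ℂ) → ℝ}

lemma IsAdmissible.log_nonpos {G : Set (Fin n → ℂ)} (hu : IsAdmissible G a u) {z : Fin n → ℂ}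
    (hz : z ∈ G) : ENNReal.log (ENNReal.ofReal (u z)) ≤ 0 := by
  rw [ENNReal.log_le_zero_iff, ENNReal.ofReal_le_one]
  exact (hu.lt_one z hz).le

/-- Liouville's theorem for admissible functions. -/
lemma IsAdmissible.comp_le_comp_zero {G : Set (Fin n → ℂ)} (hG : IsOpen G)
    (hu : IsAdmissible G a u) {γ : ℂ → Fin n → ℂ} (hγ : Differentiable ℂ γ)
    (hγG : ∀ t, γ t ∈ G) (t : ℂ) : u (γ t) ≤ u (γ 0) := by
  have := hu.log_psh.comp_le_comp_zero hG (fun z hz => hu.log_nonpos hz) hγ hγG t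
  rwa [ENNReal.log_le_log_iff, ENNReal.ofReal_le_ofReal_iff (hu.nonneg _ (hγG 0))] at this

/-- An admissible function vanishes, and is `C²`, at a point whose only zero coordinate is the
`j`-th: it vanishes on a complex line in `{z j = 0}` through `a` along which all other zero
coordinates move. -/
lemma IsAdmissible.exists_zero_of_mem_zeroIndices (hu : IsAdmissible (reinhardt α) a u)
    (ha : a ∈ reinhardt α) {j : Fin n} (hj : j ∈ zeroIndices α a) :
    ∃ p : Fin n → ℂ, p j = 0 ∧ (∀ k, k ≠ j → p k ≠ 0) ∧ u p = 0 ∧ ContDiffAt ℝ 2 u p := by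
  classical
  set b : Fin n → ℂ := fun k => if k ≠ j ∧ a k = 0 then 1 else 0 with hb
  have hγ : Differentiable ℂ fun t : ℂ => a + t • b := by fun_prop
  have hγj : ∀ t : ℂ, (a + t • b) j = 0 := fun t => by simp [hb, hj.2]
  have hγD : ∀ t : ℂ, a + t • b ∈ reinhardt α := fun t => by
    refine ⟨fun k hk => ?_, ?_⟩
    · have := ha.1 k hk
      simp [hb, this]
    · rw [absMonomial_eq_zero hj.1.ne' (hγj t)]
      exact one_pos
  have hu0 : ∀ t : ℂ, u (a + t • b) = 0 := fun t => by
    refine le_antisymm ?_ (hu.nonneg _ (hγD t))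
    have := hu.comp_le_comp_zero (isOpen_reinhardt α) hγ hγD t
    rwa [zero_smul, add_zero, hu.map_base] at this
  have hev : ∀ᶠ t in 𝓝 (0 : ℂ), ContDiffAt ℝ 2 u (a + t • b) := by
    have h := hγ.continuous.tendsto 0
    simp only [zero_smul, add_zero] at h
    exact h.eventually (hu.contDiffAt.eventually (by simp))
  obtain ⟨t, ht, ht0⟩ := ((eventually_nhdsWithin_of_eventually_nhds hev).and
    (self_mem_nhdsWithin (s := {0}ᶜ))).exists
  refine ⟨a + t • b, hγj t, fun k hk => ?_, hu0 t, ht⟩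
  by_cases h : a k = 0
  · simpa [hb, h, hk] using ht0
  · simp [hb, h]

/-- The upper bound on the slice through `p` in the `j`-th direction, by the Schwarz lemma. -/
lemma IsAdmissible.le_on_slice (hu : IsAdmissible (reinhardt α) a u) {p : Fin n → ℂ} {j : Fin n}
    (hpj : p j = 0) (hpk : ∀ k, k ≠ j → p k ≠ 0) (hup : u p = 0)
    (hpd : ContDiffAt ℝ 2 u p) (hαj : 0 < α j) {t : ℂ} (ht0 : t ≠ 0)
    (ht : Function.update p j t ∈ reinhardt α) :
    u (Function.update p j t) ≤ absMonomial α (Function.update p j t) ^ (2 / α j) := by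
  set P : ℝ := ∏ k ∈ Finset.univ.erase j, ‖p k‖ ^ α k with hP
  have hPpos : 0 < P := Finset.prod_pos fun k hk =>
    Real.rpow_pos_of_pos (norm_pos_iff.2 (hpk k (Finset.ne_of_mem_erase hk))) _
  -- the radius of the disc in which the slice meets `reinhardt α`
  set r : ℝ := P ^ (-(1 / α j)) with hr
  have hrpos : 0 < r := Real.rpow_pos_of_pos hPpos _
  have hrP : r ^ α j * P = 1 := by
    rw [hr, ← Real.rpow_mul hPpos.le, neg_mul, one_div_mul_cancel hαj.ne', Real.rpow_neg_one,
      inv_mul_cancel₀ hPpos.ne']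
  have hp0 : Function.update p j 0 = p := by rw [← hpj, Function.update_eq_self]
  have hmem : ∀ s : ℂ, ‖s‖ < r ↔ Function.update p j s ∈ reinhardt α := fun s => by
    have hlt : ‖s‖ < r ↔ absMonomial α (Function.update p j s) < 1 := by
      rw [absMonomial_update, ← hP, ← hrP, mul_lt_mul_iff_left₀ hPpos,
        Real.rpow_lt_rpow_iff (norm_nonneg _) hrpos.le hαj]
    rw [hlt]
    refine ⟨fun h => ⟨fun k hk => ?_, h⟩, fun h => h.2⟩
    have hkj : k ≠ j := by rintro rfl; exact lt_asymm hk hαj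
    rw [Function.update_of_ne hkj]
    exact hpk k hkj
  have hγ := differentiable_update p j
  obtain ⟨C, hC, hCle⟩ : ∃ C : ℝ, 0 < C ∧
      ∀ᶠ s in 𝓝 (0 : ℂ), u (Function.update p j s) - u (Function.update p j 0) ≤
        C * ‖s - 0‖ ^ 2 := by
    refine exists_le_mul_norm_sq (g := fun s : ℂ => u (Function.update p j s)) ?_ ?_
    · refine ContDiffAt.comp (0 : ℂ) (by rwa [hp0]) ?_
      exact (hγ.contDiff.restrict_scalars ℝ).contDiffAt
    · filter_upwards [ball_mem_nhds (0 : ℂ) hrpos] with s hs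
      rw [hp0, hup]
      exact hu.nonneg _ ((hmem s).1 (by simpa using hs))
  have key := hu.log_psh.comp_le_two_mul_log (isOpen_reinhardt α)
    (fun z hz => hu.log_nonpos hz) hγ (fun s hs => (hmem s).1 hs) (c := Real.log C) ?_ ht0
    ((hmem t).2 ht)
  · rw [log_ofReal_le_coe_iff] at key
    refine key.trans (le_of_eq ?_)
    have htpos : 0 < ‖t‖ := norm_pos_iff.2 ht0
    rw [absMonomial_update, ← hP, Real.rpow_def_of_pos (by positivity),
      Real.log_mul (by positivity) hPpos.ne', Real.log_rpow htpos, hr, Real.log_rpow hPpos]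
    congr 1
    field_simp
    ring
  · filter_upwards [eventually_nhdsWithin_of_eventually_nhds hCle, self_mem_nhdsWithin]
      with s hs hs0
    have hspos : 0 < ‖s‖ := norm_pos_iff.2 hs0
    rw [log_ofReal_le_coe_iff, Real.exp_add, Real.exp_log hC, two_mul, Real.exp_add,
      Real.exp_log hspos]
    rw [hp0, hup, sub_zero, sub_zero, sq] at hs
    exact hs

lemma IsAdmissible.le_of_forall_ne_zero (hu : IsAdmissible (reinhardt α) a u)
    (ha : a ∈ reinhardt α) {j : Fin n} (hj : j ∈ zeroIndices α a) {z : Fin n → ℂ}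
    (hz : z ∈ reinhardt α) (hz0 : ∀ k, z k ≠ 0) : u z ≤ absMonomial α z ^ (2 / α j) := by
  classical
  obtain ⟨p, hpj, hpk, hup, hpd⟩ := hu.exists_zero_of_mem_zeroIndices ha hj
  have hαj : (α j : ℂ) ≠ 0 := Complex.ofReal_ne_zero.2 hj.1.ne'
  -- The curve `s ↦ (q k * exp (s * w k))` joins `q`, which lies on the slice through `p`, to `z`.
  set l : Fin n → ℂ := fun k => Complex.log (z k / p k) with hl
  set w : Fin n → ℂ :=
    Function.update l j (-(∑ k ∈ Finset.univ.erase j, (α k : ℂ) * l k) / α j) with hw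
  have hwsum : ∑ k, (α k : ℂ) * w k = 0 := by
    rw [← Finset.add_sum_erase _ _ (Finset.mem_univ j)]
    have : ∑ k ∈ Finset.univ.erase j, (α k : ℂ) * w k =
        ∑ k ∈ Finset.univ.erase j, (α k : ℂ) * l k :=
      Finset.sum_congr rfl fun k hk => by
        rw [hw, Function.update_of_ne (Finset.ne_of_mem_erase hk)]
    rw [this, hw, Function.update_self]
    field_simp
    ring
  set t : ℂ := z j * Complex.exp (-w j) with ht
  set q : Fin n → ℂ := Function.update p j t with hq
  have hqz : (fun k => q k * Complex.exp (1 * w k)) = z := by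
    ext k
    rw [one_mul]
    rcases eq_or_ne k j with rfl | hk
    · rw [hq, Function.update_self, ht, mul_assoc, ← Complex.exp_add, neg_add_cancel,
        Complex.exp_zero, mul_one]
    · rw [hq, hw, Function.update_of_ne hk, Function.update_of_ne hk, hl,
        Complex.exp_log (div_ne_zero (hz0 k) (hpk k hk)), mul_div_cancel₀ _ (hpk k hk)]
  have ht0 : t ≠ 0 := mul_ne_zero (hz0 j) (Complex.exp_ne_zero _)
  have hfq : absMonomial α q = absMonomial α z := by
    rw [← absMonomial_mul_exp hwsum q 1, hqz]
  have hq0 : ∀ k, q k ≠ 0 := fun k => by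
    rcases eq_or_ne k j with rfl | hk
    · rwa [hq, Function.update_self]
    · rw [hq, Function.update_of_ne hk]
      exact hpk k hk
  have hcurve : ∀ s : ℂ, (fun k => q k * Complex.exp (s * w k)) ∈ reinhardt α := fun s =>
    ⟨fun k _ => mul_ne_zero (hq0 k) (Complex.exp_ne_zero _), by
      rw [absMonomial_mul_exp hwsum, hfq]; exact hz.2⟩
  have h1 := hu.comp_le_comp_zero (isOpen_reinhardt α)
    (γ := fun s k => q k * Complex.exp (s * w k))
    (differentiable_pi.2 fun k => by fun_prop) hcurve 1
  simp only [hqz, zero_mul, Complex.exp_zero, mul_one] at h1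
  have hqD : q ∈ reinhardt α := by simpa using hcurve 0
  exact h1.trans ((hu.le_on_slice hpj hpk hup hpd hj.1 ht0 hqD).trans_eq (by rw [← hq, hfq]))

/-- Upper bound for admissible functions. Points with zero coordinates are centres of small discs
whose boundary circles avoid the coordinate hyperplanes, so the sub-mean value inequality reduces them to
`IsAdmissible.le_of_forall_ne_zero`. -/
theorem IsAdmissible.le_absMonomial_rpow (hu : IsAdmissible (reinhardt α) a u)
    (ha : a ∈ reinhardt α) {j : Fin n} (hj : j ∈ zeroIndices α a) {z : Fin n → ℂ}
    (hz : z ∈ reinhardt α) : u z ≤ absMonomial α z ^ (2 / α j) := by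
  classical
  refine le_of_forall_gt_imp_ge_of_dense fun c hc => ?_
  have hcpos : 0 < c := (Real.rpow_nonneg (absMonomial_nonneg α z) _).trans_lt hc
  have hD := (isOpen_reinhardt α).mem_nhds hz
  have hcont : ContinuousAt (fun y => absMonomial α y ^ (2 / α j)) z :=
    ((continuousOn_absMonomial_reinhardt α).continuousAt hD).rpow_const
      (Or.inr (div_nonneg two_pos.le hj.1.le))
  obtain ⟨r, hr, hball⟩ := Metric.nhds_basis_closedBall.eventually_iff.1
    ((eventually_mem_set.2 hD).and (hcont.eventually (gt_mem_nhds hc)))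
  set b : Fin n → ℂ := fun k => if z k = 0 then (r : ℂ) else 0 with hb
  have hmem : ∀ ζ : ℂ, ‖ζ‖ ≤ 1 → z + ζ • b ∈ closedBall z r := fun ζ hζ => by
    have hbr : ‖b‖ ≤ r := (pi_norm_le_iff_of_nonneg hr.le).2 fun k => by
      by_cases h : z k = 0 <;> simp [hb, h, hr.le, abs_of_pos hr]
    rw [mem_closedBall, dist_eq_norm, add_sub_cancel_left, norm_smul]
    nlinarith [norm_nonneg ζ]
  have hsub := hu.log_psh.le_mean z b fun ζ hζ => (hball (hmem ζ hζ)).1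
  have hle := hsub.trans (circleMean_mono (g := fun _ => ((Real.log c : ℝ) : EReal))
    fun ζ hζ => ?_)
  · rw [circleMean_coe (circleIntegrable_const _ _ _), circleAverage_const,
      log_ofReal_le_coe_iff, Real.exp_log hcpos] at hle
    exact hle
  · rw [log_ofReal_le_coe_iff, Real.exp_log hcpos]
    obtain ⟨h1, h2⟩ := hball (hmem ζ hζ.le)
    refine (hu.le_of_forall_ne_zero ha hj h1 fun k => ?_).trans h2.le
    have hζ0 : ζ ≠ 0 := norm_pos_iff.1 (hζ ▸ one_pos)
    by_cases h : z k = 0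
    · simpa [hb, h, hζ0] using hr.ne'
    · simp [hb, h]

end UpperBound

/-! ### The extremal function is admissible -/

section NormRpow

variable {E : Type*} [NormedAddCommGroup E] [InnerProductSpace ℝ E]

/-- The vector field `x ↦ ‖x‖ ^ q • x` is, up to a factor, the gradient of `‖x‖ ^ (q + 2)`; its
derivative has norm at most `(1 + q) * ‖x‖ ^ q`, which tends to `0` at the origin. -/
lemma contDiff_norm_rpow_smul {q : ℝ} (hq : 0 < q) :
    ContDiff ℝ 1 fun x : E => ‖x‖ ^ q • x := by
  have hcont : Continuous fun x : E => ‖x‖ ^ q :=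
    continuous_norm.rpow_const fun _ => Or.inr hq.le
  refine contDiff_one_iff_hasFDerivAt.2 ⟨fun x => ‖x‖ ^ q • ContinuousLinearMap.id ℝ E +
    ((q * ‖x‖ ^ (q - 2)) • innerSL ℝ x).smulRight x, ?_, fun x => ?_⟩
  · refine continuous_iff_continuousAt.2 fun x => ?_
    rcases eq_or_ne x 0 with rfl | hx
    · have hval : ‖(0 : E)‖ ^ q • ContinuousLinearMap.id ℝ E +
          ((q * ‖(0 : E)‖ ^ (q - 2)) • innerSL ℝ (0 : E)).smulRight (0 : E) = 0 := by
        ext y; simp [Real.zero_rpow hq.ne']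
      rw [ContinuousAt, hval]
      refine squeeze_zero_norm (a := fun x : E => (1 + q) * ‖x‖ ^ q) (fun x => ?_) ?_
      · rcases eq_or_ne x 0 with rfl | hx
        · rw [hval, norm_zero, norm_zero]; positivity
        refine (norm_add_le _ _).trans ?_
        rw [norm_smul, ContinuousLinearMap.norm_smulRight_apply, norm_smul, innerSL_apply_norm,
          Real.norm_of_nonneg (by positivity), Real.norm_of_nonneg (by positivity)]
        have h1 : ‖x‖ ^ q * ‖ContinuousLinearMap.id ℝ E‖ ≤ ‖x‖ ^ q :=
          mul_le_of_le_one_right (by positivity) ContinuousLinearMap.norm_id_le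
        have h2 : q * ‖x‖ ^ (q - 2) * ‖x‖ * ‖x‖ = q * ‖x‖ ^ q := by
          rw [mul_assoc, mul_assoc, ← sq, ← Real.rpow_natCast ‖x‖ 2,
            ← Real.rpow_add (norm_pos_iff.2 hx)]
          norm_num
        linarith
      · have : ContinuousAt (fun x : E => (1 + q) * ‖x‖ ^ q) 0 :=
          (continuous_const.mul hcont).continuousAt
        simpa [ContinuousAt, Real.zero_rpow hq.ne'] using this
    · have h1 : ContinuousAt (fun x : E => q * ‖x‖ ^ (q - 2)) x :=
        continuousAt_const.mul (continuous_norm.continuousAt.rpow_const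
          (Or.inl (norm_ne_zero_iff.2 hx)))
      have h2 : ContinuousAt (fun x : E => (q * ‖x‖ ^ (q - 2)) • innerSL ℝ x) x :=
        h1.smul (innerSL ℝ (E := E)).continuous.continuousAt
      refine (hcont.continuousAt.smul continuousAt_const).add ?_
      exact ((ContinuousLinearMap.smulRightL ℝ E E).continuous.continuousAt.comp h2).clm_apply
        continuousAt_id
  · rcases eq_or_ne x 0 with rfl | hx
    · refine .of_isLittleO ?_
      have hlim : Tendsto (fun x : E => ‖x‖ ^ q) (𝓝 0) (𝓝 0) := by
        simpa [Real.zero_rpow hq.ne'] using hcont.tendsto 0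
      have : (fun x : E => ‖x‖ ^ q • x) =o[𝓝 0] fun x : E => (1 : ℝ) • x :=
        ((Asymptotics.isLittleO_one_iff ℝ).2 hlim).smul_isBigO (Asymptotics.isBigO_refl _ _)
      simpa [Real.zero_rpow hq.ne'] using this
    · have hn : HasFDerivAt (fun x : E => ‖x‖ ^ q) ((q * ‖x‖ ^ (q - 2)) • innerSL ℝ x) x := by
        apply HasStrictFDerivAt.hasFDerivAt
        convert! (hasStrictFDerivAt_norm_sq x).rpow_const (p := q / 2) (by simp [hx]) using 0
        simp_rw [← Real.rpow_natCast_mul (norm_nonneg _), ← Nat.cast_smul_eq_nsmul ℝ, smul_smul]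
        ring_nf
      exact hn.smul (hasFDerivAt_id x)

lemma contDiff_two_norm_rpow {p : ℝ} (hp : 2 ≤ p) : ContDiff ℝ 2 fun x : E => ‖x‖ ^ p := by
  rcases hp.eq_or_lt with rfl | hp
  · simpa using contDiff_norm_sq ℝ (n := 2) (E := E)
  rw [show (2 : WithTop ℕ∞) = 1 + 1 from by norm_num, contDiff_succ_iff_fderiv]
  refine ⟨differentiable_norm_rpow (by linarith), by simp, ?_⟩
  have h : (fderiv ℝ fun x : E => ‖x‖ ^ p) =
      fun x => p • innerSL ℝ (‖x‖ ^ (p - 2) • x) := by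
    ext x y
    rw [fderiv_norm_rpow x (by linarith)]
    simp [mul_assoc]
  rw [h]
  exact ((innerSL ℝ (E := E)).contDiff.comp (contDiff_norm_rpow_smul (by linarith))).const_smul p

end NormRpow

lemma ae_add_circleMap_mul_ne_zero {c b : ℂ} (hc : c ≠ 0) :
    ∀ᵐ θ : ℝ, c + circleMap 0 1 θ * b ≠ 0 := by
  have h : (circleMap 0 1 ⁻¹' {-c / b}).Countable :=
    (countable_singleton _).preimage_circleMap 0 one_ne_zero
  filter_upwards [h.ae_notMem volume] with θ hθ h0
  have hb : b ≠ 0 := by rintro rfl; exact hc (by simpa using h0)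
  exact hθ ((eq_div_iff hb).2 (eq_neg_of_add_eq_zero_right h0))

lemma circleIntegrable_log_norm_add_mul (c b : ℂ) :
    CircleIntegrable (fun ζ => Real.log ‖c + ζ * b‖) 0 1 :=
  MeromorphicOn.circleIntegrable_log_norm fun _ _ => by fun_prop

lemma circleAverage_log_norm_add_mul {c b : ℂ} (hc : c ≠ 0) (hb : b ≠ 0) :
    circleAverage (fun ζ => Real.log ‖c + ζ * b‖) 0 1 =
      Real.log ‖b‖ + Real.posLog ‖c / b‖ := by
  have h : circleAverage (fun ζ => Real.log ‖c + ζ * b‖) 0 1 =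
      circleAverage (fun ζ => Real.log ‖b‖ + Real.log ‖ζ + c / b‖) 0 1 := by
    rw [circleAverage_def, circleAverage_def]
    congr 1
    refine intervalIntegral.integral_congr_ae ?_
    filter_upwards [ae_add_circleMap_mul_ne_zero (b := b) hc] with θ hθ _
    have : c + circleMap 0 1 θ * b = b * (circleMap 0 1 θ + c / b) := by field_simp; ring
    rw [this] at hθ ⊢
    rw [norm_mul, Real.log_mul (norm_ne_zero_iff.2 hb)
      (norm_ne_zero_iff.2 (right_ne_zero_of_mul hθ))]
  rw [h, circleAverage_fun_add (circleIntegrable_const _ _ _)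
    (MeromorphicOn.circleIntegrable_log_norm fun _ _ => by fun_prop), circleAverage_const,
    circleAverage_log_norm_add_const_eq_posLog]

/-- The function `s * log |·|` is subharmonic for `s ≥ 0`, and harmonic on zero-free discs for
every `s`. -/
lemma mul_log_norm_le_circleAverage {c b : ℂ} {s : ℝ} (hc : s ≠ 0 → c ≠ 0)
    (hs : s < 0 → ∀ ζ : ℂ, ‖ζ‖ ≤ 1 → c + ζ * b ≠ 0) :
    s * Real.log ‖c‖ ≤ s * circleAverage (fun ζ => Real.log ‖c + ζ * b‖) 0 1 := by
  rcases eq_or_ne s 0 with rfl | hs0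
  · simp
  have hc := hc hs0
  rcases eq_or_ne b 0 with rfl | hb
  · simp [circleAverage_const]
  have hcb : Real.log ‖c / b‖ = Real.log ‖c‖ - Real.log ‖b‖ := by
    rw [norm_div, Real.log_div (norm_ne_zero_iff.2 hc) (norm_ne_zero_iff.2 hb)]
  rw [circleAverage_log_norm_add_mul hc hb]
  rcases lt_or_gt_of_ne hs0 with h | h
  · have h1 : 1 < ‖c / b‖ := by
      by_contra! hle
      exact hs h (-(c / b)) (by rwa [norm_neg]) (by field_simp; ring)
    rw [Real.posLog_eq_log (by rw [abs_norm]; exact h1.le), hcb, add_sub_cancel]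
  · refine mul_le_mul_of_nonneg_left ?_ h.le
    have : Real.log ‖c / b‖ ≤ Real.posLog ‖c / b‖ := le_max_right _ _
    linarith

lemma absMonomial_pos {n : ℕ} {β : Fin n → ℝ} {z : Fin n → ℂ} (hz : ∀ j, β j ≠ 0 → z j ≠ 0) :
    0 < absMonomial β z :=
  Finset.prod_pos fun j _ => by
    by_cases h : β j = 0
    · simp [h]
    · exact Real.rpow_pos_of_pos (norm_pos_iff.2 (hz j h)) _

lemma log_absMonomial {n : ℕ} {β : Fin n → ℝ} {z : Fin n → ℂ} (hz : ∀ j, β j ≠ 0 → z j ≠ 0) :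
    Real.log (absMonomial β z) = ∑ j, β j * Real.log ‖z j‖ := by
  have h : ∀ j, ‖z j‖ ^ β j ≠ 0 ∧ Real.log (‖z j‖ ^ β j) = β j * Real.log ‖z j‖ := fun j => by
    by_cases h : β j = 0
    · simp [h]
    · have := norm_pos_iff.2 (hz j h)
      exact ⟨(Real.rpow_pos_of_pos this _).ne', Real.log_rpow this _⟩
  rw [absMonomial, Real.log_prod fun j _ => (h j).1]
  exact Finset.sum_congr rfl fun j _ => (h j).2

/-- On a set where coordinates with negative weight do not vanish, `log |z^β| = ∑ β j * log |z j|` is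
plurisubharmonic, being so termwise. -/
lemma isPSH_log_absMonomial {n : ℕ} {β : Fin n → ℝ} {G : Set (Fin n → ℂ)}
    (hG : ∀ z ∈ G, ∀ j, β j < 0 → z j ≠ 0) :
    IsPSH G fun z => ENNReal.log (ENNReal.ofReal (absMonomial β z)) where
  ne_top z _ := by rw [ne_eq, ENNReal.log_eq_top_iff]; exact ENNReal.ofReal_ne_top
  usc := by
    refine ContinuousOn.upperSemicontinuousOn ?_
    exact (ENNReal.continuous_log.comp ENNReal.continuous_ofReal).comp_continuousOn
      ((continuousOn_absMonomial β).mono hG)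
  le_mean c b hcb := by
    -- If a coordinate with nonzero weight vanishes at the centre, then the left-hand side is `-∞`.
    by_cases hc : ∀ j, β j ≠ 0 → c j ≠ 0
    swap
    · push Not at hc
      obtain ⟨j, hj, hcj⟩ := hc
      simp [absMonomial_eq_zero hj hcj]
    set g : ℂ → ℝ := fun ζ => ∑ j, β j * Real.log ‖c j + ζ * b j‖ with hg
    have hi : ∀ j ∈ Finset.univ, CircleIntegrable
        (fun ζ => β j * Real.log ‖c j + ζ * b j‖) 0 1 := fun j _ =>
      (circleIntegrable_log_norm_add_mul (c j) (b j)).const_mul (β j)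
    have hgi : CircleIntegrable g 0 1 := CircleIntegrable.fun_sum _ hi
    calc ENNReal.log (ENNReal.ofReal (absMonomial β c))
        = ((∑ j, β j * Real.log ‖c j‖ : ℝ) : EReal) := by
          rw [ENNReal.log_ofReal_of_pos (absMonomial_pos hc), log_absMonomial hc]
      _ ≤ (circleAverage g 0 1 : ℝ) := by
          rw [EReal.coe_le_coe_iff, hg, circleAverage_fun_sum hi]
          refine Finset.sum_le_sum fun j _ => ?_
          have := mul_log_norm_le_circleAverage (hc j) (b := b j)
            fun hj ζ hζ => by simpa using hG _ (hcb ζ hζ) j hj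
          refine this.trans_eq ?_
          exact (circleAverage_fun_smul (a := β j)).symm
      _ = circleMean fun ζ => (g ζ : EReal) := (circleMean_coe hgi).symm
      _ ≤ _ := by
          refine circleMean_mono_ae ?_
          have : ∀ᵐ θ : ℝ, ∀ j, c j ≠ 0 → c j + circleMap 0 1 θ * b j ≠ 0 := by
            refine ae_all_iff.2 fun j => ?_
            by_cases h : c j = 0
            · simp [h]
            · exact (ae_add_circleMap_mul_ne_zero h).mono fun _ hθ _ => hθ
          filter_upwards [this] with θ hθ
          have hz : ∀ j, β j ≠ 0 → (c + circleMap 0 1 θ • b) j ≠ 0 := fun j hj => hθ j (hc j hj)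
          rw [ENNReal.log_ofReal_of_pos (absMonomial_pos hz), log_absMonomial hz]
          rfl

lemma contDiffAt_absMonomial {n : ℕ} {β : Fin n → ℝ} {a : Fin n → ℂ}
    (h : ∀ j, a j = 0 → β j = 0 ∨ 2 ≤ β j) : ContDiffAt ℝ 2 (absMonomial β) a := by
  refine contDiffAt_prod fun j _ => ?_
  have hj : ContDiffAt ℝ 2 (fun z : Fin n → ℂ => z j) a := by fun_prop
  by_cases ha : a j = 0
  · rcases h j ha with h0 | h2
    · simpa [h0] using contDiffAt_const
    · exact (contDiff_two_norm_rpow h2).contDiffAt.comp a hj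
  · exact (hj.norm ℝ ha).rpow_const_of_ne (norm_ne_zero_iff.2 ha)

lemma absMonomial_rpow {n : ℕ} (α : Fin n → ℝ) (c : ℝ) (z : Fin n → ℂ) :
    absMonomial α z ^ c = absMonomial (fun j => α j * c) z := by
  rw [absMonomial, ← Real.finsetProd_rpow _ _ fun _ _ => Real.rpow_nonneg (norm_nonneg _) _]
  exact Finset.prod_congr rfl fun j _ => (Real.rpow_mul (norm_nonneg _) _ _).symm

lemma isAdmissible_absMonomial_rpow {n : ℕ} {α : Fin n → ℝ} {a : Fin n → ℂ}
    (ha : a ∈ reinhardt α) {j : Fin n} (hj : j ∈ zeroIndices α a)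
    (hmin : ∀ k ∈ zeroIndices α a, α j ≤ α k) :
    IsAdmissible (reinhardt α) a fun z => absMonomial α z ^ (2 / α j) := by
  have hc : 0 < 2 / α j := div_pos two_pos hj.1
  refine ⟨fun z _ => Real.rpow_nonneg (absMonomial_nonneg α z) _,
    fun z hz => Real.rpow_lt_one (absMonomial_nonneg α z) hz.2 hc, ?_, ?_, ?_⟩
  · simp only [absMonomial_rpow]
    exact isPSH_log_absMonomial fun z hz k hk => hz.1 k (neg_of_mul_neg_left hk hc.le)
  · rw [absMonomial_eq_zero hj.1.ne' hj.2, Real.zero_rpow hc.ne']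
  · simp only [absMonomial_rpow]
    refine contDiffAt_absMonomial fun k hk => ?_
    rcases lt_trichotomy (α k) 0 with h | h | h
    · exact absurd hk (ha.1 k h)
    · simp [h]
    · right
      rw [mul_div_assoc', le_div_iff₀ hj.1]
      linarith [hmin k ⟨h, hk⟩]

end Sibony

theorem theorem1 (n : ℕ) (hn : 2 ≤ n) (α : Fin n → ℝ) (hα : α ≠ 0)
    (a : Fin n → ℂ) (ha : a ∈ Sibony.reinhardt α) (hσ : 2 ≤ Sibony.sigma α a) :
    ∀ z ∈ Sibony.reinhardt α,
      Sibony.sibony (Sibony.reinhardt α) a z =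
        Sibony.absMonomial α z ^ (1 / Sibony.mu α a) := by
  intro z hz
  have hne : (Sibony.zeroIndices α a).Nonempty :=
    Set.nonempty_of_ncard_ne_zero (show Sibony.sigma α a ≠ 0 by omega)
  obtain ⟨j, hj, hjmin⟩ := Set.exists_min_image _ α (Set.toFinite _) hne
  have hμ : Sibony.mu α a = α j :=
    IsLeast.csInf_eq ⟨⟨j, hj, rfl⟩, by rintro _ ⟨k, hk, rfl⟩; exact hjmin k hk⟩
  have hsqrt : √(Sibony.absMonomial α z ^ (2 / α j)) = Sibony.absMonomial α z ^ (1 / α j) := by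
    rw [Real.sqrt_eq_rpow, ← Real.rpow_mul (Sibony.absMonomial_nonneg α z)]
    congr 1
    ring
  rw [hμ, ← hsqrt]
  refine IsGreatest.csSup_eq ⟨⟨_, Sibony.isAdmissible_absMonomial_rpow ha hj hjmin, rfl⟩, ?_⟩
  rintro _ ⟨u, hu, rfl⟩
  exact Real.sqrt_le_sqrt (hu.le_absMonomial_rpow ha hj hz)
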